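/- Let $\nu\in\mathbb C$ with $\nu\notin\{0,-1,-2,\dots\}$, let $J_\nu(z)=\sum_{n\ge 0}\frac{(-1)^n(z/2)^{2n+\nu}}{n!\,\Gamma(\nu+n+1)}$ be the Bessel function of the first kind, and let $J_\nu'$ be its derivative with respect to $z$. Then $J_\nu'$ has infinitely many nontrivial (i.e. nonzero) zeros; as zeros of the even entire function $z^{1-\nu}J_\nu'(z)$ they occur in pairs $\pm j'_{\nu k}$, $k=1,2,\dots$, where the $j'_{\nu k}$ are the zeros with $-\pi/2<\arg z\le\pi/2$ (principal branch of $J_\nu$), each repeated according to its multiplicity. For every $n\ge 1$ the series $$\tau_n=\sum_{k=1}^\infty (j'_{\nu k})^{-2n}$$ converges absolutely, and $$\tau_1=\frac{\nu+2}{4\nu(\nu+1)},\qquad \tau_2=\frac{-4\nu^2\tau_1^2-4\nu\tau_1+1}{-4\nu^2(\nu+2)},\qquad \nu^2(\nu+3)\tau_3=(\nu+1)\tau_2+2\nu^2\tau_1\tau_2-\tau_1^2,$$ and, for every integer $k\ge 3$, $$-\nu^2(k+\nu+1)\tau_{k+1}=-(k+\nu-1)\tau_k-\nu^2\sum_{m=1}^{k}\tau_m\tau_{k-m+1}+\sum_{m=1}^{k-1}\tau_m\tau_{k-m}.$$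 In particular, $$\tau_2=\sum_{k=1}^\infty (j'_{\nu k})^{-4}=\frac{\nu^2+8\nu+8}{16\,\nu^2(\nu+1)^2(\nu+2)},\qquad \tau_3=\sum_{k=1}^\infty (j'_{\nu k})^{-6}=\frac{\nu^3+16\nu^2+38\nu+24}{32\,\nu^3(\nu+1)^3(\nu+2)(\nu+3)}.$$ -/

import Mathlib

/-- The Bessel function of the first kind,
`J_ν(z) = ∑ₙ (-1)ⁿ (z/2)^(2n+ν) / (n! Γ(ν+n+1))`, with the principal branch of the power.
It is holomorphic in `z` off the half-line `(-∞, 0]`. -/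
noncomputable def besselJ (ν z : ℂ) : ℂ :=
  ∑' n : ℕ, (-1) ^ n * (z / 2) ^ (2 * (n : ℂ) + ν)
    / ((n.factorial : ℂ) * Complex.Gamma (ν + n + 1))

/-- The derivative `J_ν'(z)` with respect to `z`. -/
noncomputable def besselJDeriv (ν z : ℂ) : ℂ :=
  deriv (besselJ ν) z

/-- The half-plane `-π/2 < arg z ≤ π/2`, `z ≠ 0`, which contains exactly one point of every pair
`±z` with `z ≠ 0`, and lies in the domain of holomorphy of `J_ν`. -/
def halfPlane : Set ℂ :=
  {z | 0 < z.re ∨ (z.re = 0 ∧ 0 < z.im)}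

/-- `j 0, j 1, j 2, …` lists the nontrivial zeros of `J_ν'` up to sign (one zero of every pair
`±z`), each one repeated according to its multiplicity. -/
structure IsBesselDerivZeroSeq (ν : ℂ) (j : ℕ → ℂ) : Prop where
  mem : ∀ k, j k ∈ halfPlane
  count : ∀ z ∈ halfPlane, {k | j k = z}.encard = analyticOrderAt (besselJDeriv ν) z

/-- The power sum `τ_n = ∑ₖ (j k)^(-2n)`. -/
noncomputable def rayleighTau (j : ℕ → ℂ) (n : ℕ) : ℂ :=
  ∑' k, ((j k) ^ (2 * n))⁻¹

open Filter Topology Metric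

/-! Put x = z². The function F(x) = 2(z/2)^(1-ν) J_ν'(z) is entire in x, F(0) ≠ 0, and |F(x)| ≤ C
exp(B√|x|). Its zeros are the squares of the zeros in the half-plane, with the same multiplicities
(`IsBesselDerivZeroSeq.listsZeros`).

Growth of order at most 1/2 makes the reciprocals of the zeros w_k absolutely summable and gives
F'/F = ∑ 1/(x - w_k) near 0 (`hasSum_logDeriv`). Instead of a Hadamard product, the zeros with |w_k|
≤ R are divided out; the quotient has logarithmic derivative O(R^(-1/2)) by the maximum principle
and Borel–Carathéodory. Hence T = ∑ τ_n xⁿ satisfies xF' = -TF. Finitely many zeros would make F a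
polynomial, but none of its Taylor coefficients vanishes.

Write J_ν = (z/2)^ν G(x). Bessel's equation becomes the system F = 2xG' + νG, 2xF' + νF = (ν² - x)G.
Eliminating G gives a Riccati equation for T (`powerSeries_riccati`), whose coefficients are the
stated recurrences. -/

/-- The family `w` lists the zeros of `f` with multiplicity. -/
def ListsZeros {ι : Type*} (f : ℂ → ℂ) (w : ι → ℂ) : Prop :=
  ∀ z, {k | w k = z}.encard = analyticOrderAt f z

/-! ### Dividing an entire function by finitely many zeros. -/

namespace ListsZeros

variable {ι : Type*} {f : ℂ → ℂ} {w : ι → ℂ}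

lemma apply_eq_zero (hw : ListsZeros f w) (k : ι) : f (w k) = 0 := by
  apply apply_eq_zero_of_analyticOrderAt_ne_zero
  rw [← hw, Set.encard_ne_zero]
  exact ⟨k, rfl⟩

lemma ne_zero (hw : ListsZeros f w) (h0 : f 0 ≠ 0) (k : ι) : w k ≠ 0 := by
  intro h
  exact h0 (h ▸ hw.apply_eq_zero k)

lemma exists_le_norm (hw : ListsZeros f w) (hf : Differentiable ℂ f) (h0 : f 0 ≠ 0) :
    ∃ δ > 0, ∀ k, δ ≤ ‖w k‖ := by
  have : ∀ᶠ z in 𝓝 (0 : ℂ), f z ≠ 0 := hf.continuous.continuousAt.eventually_ne h0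
  obtain ⟨δ, hδ, h⟩ := Metric.eventually_nhds_iff.1 this
  refine ⟨δ, hδ, fun k => ?_⟩
  by_contra! hk
  exact h (by simpa using hk) (hw.apply_eq_zero k)

/-- An entire function may be divided by finitely many of its listed zeros. -/
lemma exists_eq_prod_mul (hw : ListsZeros f w) (hf : Differentiable ℂ f) (h0 : f 0 ≠ 0)
    (S : Finset ι) :
    ∃ g : ℂ → ℂ, Differentiable ℂ g ∧ (∀ z, f z = (∏ k ∈ S, (1 - z / w k)) * g z) ∧
      ∀ z, {k | k ∈ S ∧ w k = z}.encard + analyticOrderAt g z = analyticOrderAt f z := by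
  classical
  induction S using Finset.induction_on with
  | empty => exact ⟨f, hf, by simp, by simp⟩
  | insert a S ha ih =>
    obtain ⟨g, hg, hfg, hord⟩ := ih
    have hwa := hw.ne_zero h0 a
    have hga : g (w a) = 0 := by
      apply apply_eq_zero_of_analyticOrderAt_ne_zero
      -- If g did not vanish at `w a`, the indices in S would already exhaust the fibre over `w a`,
      -- and a would lie in S.
      intro h
      have h1 := hord (w a)
      rw [h, add_zero, ← hw] at h1
      have hfin : {k | k ∈ S ∧ w k = w a}.Finite := S.finite_toSet.subset fun k hk => hk.1
      have h2 := hfin.eq_of_subset_of_encard_le (fun k hk => hk.2) h1.ge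
      exact ha (h2.symm ▸ (rfl : w a = w a) : a ∈ {k | k ∈ S ∧ w k = w a}).1
    have hd : Differentiable ℂ (dslope g (w a)) := by
      rw [← differentiableOn_univ] at hg ⊢
      exact (Complex.differentiableOn_dslope univ_mem).2 hg
    have hfac : ∀ z, g z = (1 - z / w a) * (-w a * dslope g (w a) z) := by
      intro z
      have := sub_smul_dslope g (w a) z
      rw [hga, sub_zero, smul_eq_mul] at this
      rw [← this]
      field_simp
      ring
    refine ⟨fun z => -w a * dslope g (w a) z, hd.const_mul _, fun z => ?_, fun z => ?_⟩
    · rw [hfg, Finset.prod_insert ha, hfac z]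
      ring
    · have hg' : g = (fun z => 1 - z / w a) * (fun z => -w a * dslope g (w a) z) := funext hfac
      have han : AnalyticAt ℂ (fun z => 1 - z / w a) z :=
        (by fun_prop : Differentiable ℂ fun z => 1 - z / w a).analyticAt z
      have ho : analyticOrderAt (fun z => 1 - z / w a) z = if w a = z then 1 else 0 := by
        split_ifs with h
        · subst h
          apply AnalyticAt.analyticOrderAt_eq_one_of_zero_deriv_ne_zero han
          · simp [hwa]
          · simp [hwa]
        · rw [han.analyticOrderAt_eq_zero, sub_ne_zero, ne_comm, Ne, div_eq_one_iff_eq hwa]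
          exact fun h' => h h'.symm
      rw [← hord, hg', analyticOrderAt_mul han ((hd.const_mul _).analyticAt z), ho, ← hg',
        ← add_assoc]
      congr 1
      split_ifs with h
      · have : {k | k ∈ insert a S ∧ w k = z} = insert a {k | k ∈ S ∧ w k = z} := by
          ext k; simp only [Finset.mem_insert, Set.mem_ofPred_eq, Set.mem_insert_iff]; grind
        rw [this, Set.encard_insert_of_notMem (fun h' => ha h'.1)]
      · rw [add_zero]
        congr 1
        ext k; simp only [Finset.mem_insert, Set.mem_ofPred_eq]; grind

/-- The quotient by zeros in `‖z‖ ≤ R` obeys the bound for `f` on `‖z‖ ≤ 4R`, with a gain. -/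
lemma three_pow_mul_norm_le {R M : ℝ} (hR : 0 < R) {S : Finset ι} (hS : ∀ k ∈ S, ‖w k‖ ≤ R)
    (hw0 : ∀ k, w k ≠ 0)
    {g : ℂ → ℂ} (hg : Differentiable ℂ g) (hfg : ∀ z, f z = (∏ k ∈ S, (1 - z / w k)) * g z)
    (hM : ∀ z, ‖z‖ ≤ 4 * R → ‖f z‖ ≤ M) {z : ℂ} (hz : ‖z‖ ≤ 4 * R) :
    3 ^ S.card * ‖g z‖ ≤ M := by
  have key : ‖g z‖ ≤ M / 3 ^ S.card := by
    refine Complex.norm_le_of_forall_mem_frontier_norm_le (U := ball 0 (4 * R)) isBounded_ball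
      hg.diffContOnCl (fun u hu => ?_) ?_
    · rw [frontier_ball _ (by positivity), mem_sphere_zero_iff_norm] at hu
      rw [le_div_iff₀ (by positivity), mul_comm]
      refine le_trans ?_ (hM u hu.le)
      rw [hfg, norm_mul, norm_prod, ← Finset.prod_const]
      gcongr with k hk
      -- On |u| = 4R each factor satisfies |1 - u/w_k| ≥ 4 - 1 = 3; the maximum principle carries
      -- the gain inside.
      have h1 : 4 ≤ ‖u / w k‖ := by
        rw [norm_div, hu, le_div_iff₀ (norm_pos_iff.2 (hw0 k))]
        linarith [hS k hk]
      have h2 := norm_sub_norm_le (u / w k) 1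
      rw [norm_sub_rev, norm_one] at h2
      linarith
    · rw [closure_ball _ (by positivity)]
      simpa using hz
  rwa [le_div_iff₀ (by positivity), mul_comm] at key

end ListsZeros

/-! ### Zero counting, summability and the logarithmic derivative in order at most 1/2. -/

/-- If at most `K √R` terms of a sequence are at most `R`, its reciprocals are summable. -/
lemma summable_inv_of_card_le_sqrt {ι : Type*} {a : ι → ℝ} {δ K : ℝ} (hδ : 0 < δ)
    (ha : ∀ k, δ ≤ a k)
    (hK : ∀ R, δ ≤ R → ∀ S : Finset ι, (∀ k ∈ S, a k ≤ R) → (S.card : ℝ) ≤ K * √R) :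
    Summable fun k => (a k)⁻¹ := by
  classical
  -- The shell δ4^m ≤ a < δ4^(m+1) has at most 2K√δ·2^m members, each contributing at most 1/(δ4^m):
  -- a geometric series of ratio 1/2.
  have hm : ∀ k, ∃ m : ℕ, (4 : ℝ) ^ m ≤ a k / δ ∧ a k / δ < 4 ^ (m + 1) := fun k =>
    exists_nat_pow_near ((one_le_div hδ).2 (ha k)) (by norm_num)
  choose m hm1 hm2 using hm
  have hK0 : 0 ≤ K := by
    have := hK δ le_rfl ∅ (by simp)
    have h2 : 0 < √δ := Real.sqrt_pos.2 hδ
    by_contra! h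
    have := mul_neg_of_neg_of_pos h h2
    simp at *
    linarith
  have hsum : Summable fun n : ℕ => (2 * K * √δ / δ) * (1 / 2 : ℝ) ^ n :=
    summable_geometric_two.mul_left _
  refine summable_of_sum_le (c := ∑' n : ℕ, (2 * K * √δ / δ) * (1 / 2 : ℝ) ^ n)
    (fun k => inv_nonneg.2 (hδ.le.trans (ha k))) fun S => ?_
  rw [← Finset.sum_fiberwise_of_maps_to (t := S.image m) (g := m)
    (fun k hk => Finset.mem_image_of_mem m hk)]
  refine le_trans (Finset.sum_le_sum fun n _ => ?_)
    (hsum.sum_le_tsum (S.image m) fun _ _ => by positivity)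
  calc ∑ k ∈ S with m k = n, (a k)⁻¹ ≤ ∑ k ∈ S with m k = n, (δ * 4 ^ n)⁻¹ := by
        refine Finset.sum_le_sum fun k hk => ?_
        rw [Finset.mem_filter] at hk
        have := hm1 k
        rw [hk.2, le_div_iff₀ hδ] at this
        gcongr
        linarith
    _ = ((S.filter fun k => m k = n).card : ℝ) * (δ * 4 ^ n)⁻¹ := by
        rw [Finset.sum_const, nsmul_eq_mul]
    _ ≤ (K * √(δ * 4 ^ (n + 1))) * (δ * 4 ^ n)⁻¹ := by
        gcongr
        apply hK
        · exact le_mul_of_one_le_right hδ.le (one_le_pow₀ (by norm_num))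
        · intro k hk
          rw [Finset.mem_filter] at hk
          have := hm2 k
          rw [hk.2, div_lt_iff₀ hδ] at this
          linarith
    _ = (2 * K * √δ / δ) * (1 / 2 : ℝ) ^ n := by
        have h4 : (4 : ℝ) = 2 ^ 2 := by norm_num
        rw [Real.sqrt_mul hδ.le, h4, ← pow_mul, mul_comm 2 (n + 1), pow_mul,
          Real.sqrt_sq (by positivity), one_div, inv_pow, ← pow_mul]
        field_simp
        ring

/-- A bound for the logarithmic derivative of a nonvanishing holomorphic function. -/
lemma norm_logDeriv_le_of_forall_ne_zero {g : ℂ → ℂ} {R M : ℝ} (hR : 0 < R)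
    (hg : Differentiable ℂ g) (hne : ∀ z ∈ ball (0 : ℂ) R, g z ≠ 0)
    (hM : ∀ z ∈ ball (0 : ℂ) R, ‖g z‖ ≤ M) {z : ℂ} (hz : ‖z‖ ≤ R / 4) :
    ‖logDeriv g z‖ ≤ 8 * (Real.log (M / ‖g 0‖) + 1) / R := by
  have h0mem : (0 : ℂ) ∈ ball (0 : ℂ) R := mem_ball_self hR
  have hd : DifferentiableOn ℂ (logDeriv g) (ball 0 R) := fun u hu =>
    ((hg.deriv u).div (hg u) (hne u hu)).differentiableWithinAt
  -- A primitive of g'/g is a holomorphic logarithm of g/g(0), so Re h ≤ log(M/|g(0)|).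
  obtain ⟨h, h0, hh⟩ := hd.isExactOn_ball.with_val_at 0 0
  have hexp : ∀ u ∈ ball (0 : ℂ) R, g u = g 0 * Complex.exp (h u) := by
    intro u hu
    have hder : ∀ v ∈ ball (0 : ℂ) R,
        HasDerivAt (fun v => g v * Complex.exp (-h v)) 0 v := by
      intro v hv
      refine ((hg v).hasDerivAt.mul (hh v hv).neg.cexp).congr_deriv ?_
      rw [logDeriv_apply]
      field_simp [hne v hv]
      ring
    have := isOpen_ball.is_const_of_deriv_eq_zero (convex_ball (0 : ℂ) R).isPreconnected
      (fun v hv => (hder v hv).differentiableAt.differentiableWithinAt)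
      (fun v hv => (hder v hv).deriv) hu h0mem
    simp only [h0, neg_zero, Complex.exp_zero, mul_one] at this
    rw [← this, mul_assoc, ← Complex.exp_add]
    simp
  have hg0 : 0 < ‖g 0‖ := norm_pos_iff.2 (hne 0 h0mem)
  have hMg : 1 ≤ M / ‖g 0‖ := (one_le_div hg0).2 (hM 0 h0mem)
  have hA : 0 ≤ Real.log (M / ‖g 0‖) := Real.log_nonneg hMg
  -- The added 1 keeps A strictly positive, as Borel–Carathéodory requires.
  set A := Real.log (M / ‖g 0‖) + 1 with hAdef
  have hApos : 0 < A := by linarith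
  have hdh : DifferentiableOn ℂ h (ball 0 R) := fun u hu =>
    (hh u hu).differentiableAt.differentiableWithinAt
  have hre : Set.MapsTo h (ball 0 R) {z | z.re ≤ A} := by
    intro u hu
    have h1 := hM u hu
    rw [hexp u hu, norm_mul, Complex.norm_exp, mul_comm, ← le_div_iff₀ hg0] at h1
    have h2 := (Real.le_log_iff_exp_le (by linarith)).2 h1
    simp only [Set.mem_ofPred_eq]
    linarith
  have hbound : ∀ u : ℂ, ‖u‖ ≤ R / 2 → ‖h u‖ ≤ 2 * A := by
    intro u hu
    have := Complex.borelCaratheodory_zero hApos hdh hre hR (z := u)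
      (by rw [mem_ball_zero_iff]; linarith) h0
    refine this.trans ?_
    rw [div_le_iff₀ (by linarith)]
    nlinarith
  have hzR : z ∈ ball (0 : ℂ) R := by rw [mem_ball_zero_iff]; linarith
  rw [← (hh z hzR).deriv]
  have hsub : closedBall z (R / 4) ⊆ ball 0 R := by
    intro u hu
    rw [mem_closedBall, dist_eq_norm] at hu
    rw [mem_ball_zero_iff]
    have := norm_sub_norm_le u z
    linarith
  -- Cauchy's estimate on radius R/4, where |h| ≤ 2A, gives |h'| ≤ 8A/R.
  have := Complex.norm_deriv_le_of_forall_mem_sphere_norm_le (c := z) (R := R / 4) (f := h)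
    (C := 2 * A) (by positivity) (hdh.diffContOnCl_ball hsub) ?_
  · refine this.trans (le_of_eq ?_)
    field_simp
    ring
  · intro u hu
    apply hbound
    rw [mem_sphere, dist_eq_norm] at hu
    have := norm_sub_norm_le u z
    linarith

namespace ListsZeros

variable {ι : Type*} {f : ℂ → ℂ} {w : ι → ℂ} {C B : ℝ}

lemma norm_le_of_growth (hB : 0 ≤ B) (hC : 0 < C)
    (hgrow : ∀ z, ‖f z‖ ≤ C * Real.exp (B * √‖z‖)) {R : ℝ} (z : ℂ) (hz : ‖z‖ ≤ 4 * R) :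
    ‖f z‖ ≤ C * Real.exp (2 * B * √R) := by
  refine (hgrow z).trans ?_
  have h4 : √‖z‖ ≤ 2 * √R := by
    refine (Real.sqrt_le_sqrt hz).trans (le_of_eq ?_)
    rw [Real.sqrt_mul (by norm_num), show (4 : ℝ) = 2 ^ 2 by norm_num,
      Real.sqrt_sq (by norm_num)]
  gcongr C * Real.exp ?_
  nlinarith

/-- A Jensen-type bound: at the origin g(0) = f(0), so 3^N |f(0)| ≤ C exp(2B√R) for N = |S|; take
logarithms and use log 3 ≥ 1. -/
lemma card_le_of_growth (hw : ListsZeros f w) (hf : Differentiable ℂ f) (h0 : f 0 ≠ 0)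
    (hB : 0 ≤ B) (hC : 0 < C) (hgrow : ∀ z, ‖f z‖ ≤ C * Real.exp (B * √‖z‖))
    {R : ℝ} (hR : 0 < R) {S : Finset ι} (hS : ∀ k ∈ S, ‖w k‖ ≤ R) :
    (S.card : ℝ) ≤ Real.log (C / ‖f 0‖) + 2 * B * √R := by
  obtain ⟨g, hg, hfg, -⟩ := hw.exists_eq_prod_mul hf h0 S
  have hM := norm_le_of_growth hB hC hgrow (R := R)
  have h := three_pow_mul_norm_le hR hS (hw.ne_zero h0) hg hfg hM (z := 0) (by simpa using hR.le)
  have hg0 : g 0 = f 0 := by simp [hfg 0]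
  rw [hg0] at h
  have hf0 : 0 < ‖f 0‖ := norm_pos_iff.2 h0
  have h1 : (3 : ℝ) ^ S.card ≤ C / ‖f 0‖ * Real.exp (2 * B * √R) := by
    rw [div_mul_eq_mul_div, le_div_iff₀ hf0]
    exact h
  have h2 := Real.log_le_log (by positivity) h1
  rw [Real.log_pow, Real.log_mul (by positivity) (Real.exp_pos _).ne', Real.log_exp] at h2
  have h3 : 1 ≤ Real.log 3 := by
    rw [Real.le_log_iff_exp_le (by norm_num)]
    exact Real.exp_one_lt_three.le
  nlinarith [(Nat.cast_nonneg S.card : (0 : ℝ) ≤ S.card)]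

lemma finite_norm_le (hw : ListsZeros f w) (hf : Differentiable ℂ f) (h0 : f 0 ≠ 0)
    (hB : 0 ≤ B) (hC : 0 < C) (hgrow : ∀ z, ‖f z‖ ≤ C * Real.exp (B * √‖z‖))
    (R : ℝ) : {k | ‖w k‖ ≤ R}.Finite := by
  by_contra hinf
  obtain ⟨n, hn⟩ := exists_nat_gt (Real.log (C / ‖f 0‖) + 2 * B * √(max R 1))
  obtain ⟨S, hS, hcard⟩ := Set.Infinite.exists_subset_card_eq hinf n
  have := hw.card_le_of_growth hf h0 hB hC hgrow (R := max R 1) (by positivity) (S := S)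
    fun k hk => (hS hk).trans (le_max_left _ _)
  rw [hcard] at this
  linarith

lemma summable_inv_norm (hw : ListsZeros f w) (hf : Differentiable ℂ f) (h0 : f 0 ≠ 0)
    (hB : 0 ≤ B) (hC : 0 < C) (hgrow : ∀ z, ‖f z‖ ≤ C * Real.exp (B * √‖z‖)) :
    Summable fun k => ‖w k‖⁻¹ := by
  obtain ⟨δ, hδ, hle⟩ := hw.exists_le_norm hf h0
  have hCf : ‖f 0‖ ≤ C := by simpa using hgrow 0
  have hlog : 0 ≤ Real.log (C / ‖f 0‖) :=
    Real.log_nonneg ((one_le_div (norm_pos_iff.2 h0)).2 hCf)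
  have hs : 0 < √δ := Real.sqrt_pos.2 hδ
  -- For R ≥ δ the constant term of the count is absorbed using 1 ≤ √R/√δ.
  refine summable_inv_of_card_le_sqrt (K := Real.log (C / ‖f 0‖) / √δ + 2 * B) hδ hle
    fun R hR S hS => ?_
  refine (hw.card_le_of_growth hf h0 hB hC hgrow (hδ.trans_le hR) hS).trans ?_
  rw [add_mul]
  gcongr
  rw [div_mul_eq_mul_div, le_div_iff₀ hs]
  exact mul_le_mul_of_nonneg_left (Real.sqrt_le_sqrt hR) hlog

lemma logDeriv_prod_mul {S : Finset ι} {g : ℂ → ℂ} (hg : Differentiable ℂ g)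
    (hw0 : ∀ k, w k ≠ 0) (hfg : ∀ z, f z = (∏ k ∈ S, (1 - z / w k)) * g z) {z : ℂ}
    (hz : f z ≠ 0) :
    logDeriv f z = ∑ k ∈ S, (z - w k)⁻¹ + logDeriv g z := by
  rw [funext hfg]
  rw [hfg, mul_ne_zero_iff] at hz
  have hd : ∀ k ∈ S, DifferentiableAt ℂ (fun z => 1 - z / w k) z := fun k _ => by fun_prop
  rw [logDeriv_mul z hz.1 hz.2 (by fun_prop) (hg z)]
  congr 1
  rw [logDeriv_prod (Finset.prod_ne_zero_iff.1 hz.1) hd]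
  refine Finset.sum_congr rfl fun k hk => ?_
  have h1 := Finset.prod_ne_zero_iff.1 hz.1 k hk
  have h2 : z - w k ≠ 0 := by
    contrapose! h1
    rw [sub_eq_zero.1 h1, div_self (hw0 k), sub_self]
  rw [logDeriv_apply]
  have : deriv (fun z => 1 - z / w k) z = -(w k)⁻¹ := by simp
  rw [this, eq_comm, inv_eq_one_div, div_eq_div_iff h2 h1]
  field_simp [hw0 k]
  ring

/-- The logarithmic derivative of an entire function of order at most `1/2` near the origin. -/
lemma hasSum_logDeriv (hw : ListsZeros f w) (hf : Differentiable ℂ f) (h0 : f 0 ≠ 0)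
    (hB : 0 ≤ B) (hC : 0 < C) (hgrow : ∀ z, ‖f z‖ ≤ C * Real.exp (B * √‖z‖))
    {δ : ℝ} (hle : ∀ k, δ ≤ ‖w k‖) {z : ℂ} (hz : ‖z‖ ≤ δ / 2) (hfz : f z ≠ 0) :
    HasSum (fun k => (z - w k)⁻¹) (logDeriv f z) := by
  have hw0 := hw.ne_zero h0
  have hsum : Summable fun k => (z - w k)⁻¹ := by
    refine Summable.of_norm_bounded
      ((hw.summable_inv_norm hf h0 hB hC hgrow).mul_left 2) fun k => ?_
    have hwk : 0 < ‖w k‖ := norm_pos_iff.2 (hw0 k)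
    rw [norm_inv, ← inv_inv (2 : ℝ), ← mul_inv]
    have h1 := norm_sub_norm_le (w k) z
    rw [norm_sub_rev] at h1
    have h2 := hle k
    refine inv_anti₀ (by positivity) ?_
    linarith
  have hfin := hw.finite_norm_le hf h0 hB hC hgrow
  -- The finite sets of zeros with |w_k| ≤ R exhaust the index set, so the sum over all zeros is the
  -- limit along R.
  have hT : Tendsto (fun R : ℝ => (hfin R).toFinset) atTop atTop := by
    rw [Filter.tendsto_atTop]
    intro S
    obtain ⟨R₀, hR₀⟩ : ∃ R₀, ∀ k ∈ S, ‖w k‖ ≤ R₀ :=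
      ⟨∑ k ∈ S, ‖w k‖, fun k hk =>
        Finset.single_le_sum (f := fun k => ‖w k‖) (fun _ _ => norm_nonneg _) hk⟩
    filter_upwards [eventually_ge_atTop R₀] with R hR k hk
    simpa using (hR₀ k hk).trans hR
  have h1 := hsum.hasSum.comp hT
  have hlim : Tendsto (fun R : ℝ => 8 * (Real.log (C / ‖f 0‖) + 1 + 2 * B * √R) / R) atTop
      (𝓝 0) := by
    have ha : Tendsto (fun R : ℝ => 8 * (Real.log (C / ‖f 0‖) + 1) * R⁻¹ + 16 * B * (√R)⁻¹)
        atTop (𝓝 (8 * (Real.log (C / ‖f 0‖) + 1) * 0 + 16 * B * 0)) :=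
      (tendsto_inv_atTop_zero.const_mul _).add
        ((tendsto_inv_atTop_zero.comp Real.tendsto_sqrt_atTop).const_mul _)
    simp only [mul_zero, add_zero] at ha
    refine ha.congr' ?_
    filter_upwards [eventually_gt_atTop 0] with R hR
    have hs : 0 < √R := Real.sqrt_pos.2 hR
    have hsq := Real.sq_sqrt hR.le
    field_simp
    linear_combination (-16 * B) * hsq
  have h2 : Tendsto (fun R : ℝ => logDeriv f z - ∑ k ∈ (hfin R).toFinset, (z - w k)⁻¹) atTop
      (𝓝 0) := by
    refine squeeze_zero_norm' ?_ hlim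
    filter_upwards [eventually_gt_atTop 0, eventually_ge_atTop (4 * ‖z‖)] with R hR hRz
    obtain ⟨g, hg, hfg, hord⟩ := hw.exists_eq_prod_mul hf h0 (hfin R).toFinset
    rw [logDeriv_prod_mul hg hw0 hfg hfz, add_sub_cancel_left]
    have hM := norm_le_of_growth hB hC hgrow (R := R)
    have hgM : ∀ u ∈ ball (0 : ℂ) R, ‖g u‖ ≤ C * Real.exp (2 * B * √R) := by
      intro u hu
      rw [mem_ball_zero_iff] at hu
      have := three_pow_mul_norm_le hR (fun k hk => by simpa using hk) hw0 hg hfg hM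
        (z := u) (by linarith)
      refine le_trans (le_mul_of_one_le_left (norm_nonneg _) (one_le_pow₀ (by norm_num))) this
    -- Every listed zero in the disc has been divided out; finiteness of the fibre permits
    -- cancelling its cardinality in `ℕ∞`.
    have hgne : ∀ u ∈ ball (0 : ℂ) R, g u ≠ 0 := by
      intro u hu
      rw [mem_ball_zero_iff] at hu
      have h5 := hord u
      have h6 : {k | k ∈ (hfin R).toFinset ∧ w k = u} = {k | w k = u} := by
        ext k
        simp only [Set.Finite.mem_toFinset, Set.mem_ofPred_eq, and_iff_right_iff_imp]
        rintro rfl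
        exact hu.le
      have hfinu : {k | w k = u}.Finite := (hfin R).subset fun k hk => by
        rw [Set.mem_ofPred_eq] at hk ⊢
        rw [hk]
        exact hu.le
      rw [h6, ← hw u] at h5
      have h7 : analyticOrderAt g u = 0 := by
        rw [← hfinu.cast_ncard_eq] at h5
        exact ENat.add_right_injective_of_ne_top (ENat.natCast_ne_top _) (h5.trans (add_zero _).symm)
      exact (hg.analyticAt u).analyticOrderAt_eq_zero.1 h7
    have hg0 : g 0 = f 0 := by simp [hfg 0]
    refine (norm_logDeriv_le_of_forall_ne_zero hR hg hgne hgM (by linarith)).trans (le_of_eq ?_)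
    have hf0 : 0 < ‖f 0‖ := norm_pos_iff.2 h0
    rw [hg0, mul_div_right_comm C, Real.log_mul (by positivity) (Real.exp_pos _).ne', Real.log_exp]
    ring
  have h3 : Tendsto (fun R : ℝ => ∑ k ∈ (hfin R).toFinset, (z - w k)⁻¹) atTop
      (𝓝 (logDeriv f z)) := by
    simpa using (tendsto_const_nhds (x := logDeriv f z)).sub h2
  rw [← tendsto_nhds_unique h1 h3]
  exact hsum.hasSum

/-- The Taylor coefficients of the logarithmic derivative at the origin are the power sums of the
reciprocals of the zeros. -/
lemma hasSum_powerSum (hw : ListsZeros f w) (hf : Differentiable ℂ f) (h0 : f 0 ≠ 0)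
    (hB : 0 ≤ B) (hC : 0 < C) (hgrow : ∀ z, ‖f z‖ ≤ C * Real.exp (B * √‖z‖)) :
    ∀ᶠ z in 𝓝 0, f z ≠ 0 ∧ Summable (fun n : ℕ => ‖(∑' k, (w k ^ (n + 1))⁻¹) * z ^ n‖) ∧
      HasSum (fun n : ℕ => (∑' k, (w k ^ (n + 1))⁻¹) * z ^ n) (-logDeriv f z) := by
  obtain ⟨δ, hδ, hle⟩ := hw.exists_le_norm hf h0
  have hs := hw.summable_inv_norm hf h0 hB hC hgrow
  filter_upwards [hf.continuous.continuousAt.eventually_ne h0,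
    closedBall_mem_nhds (0 : ℂ) (half_pos hδ)] with z hfz hz
  rw [mem_closedBall_zero_iff] at hz
  have hw0 := hw.ne_zero h0
  have hbound : ∀ k (n : ℕ), ‖(w k ^ (n + 1))⁻¹ * z ^ n‖ ≤ ‖w k‖⁻¹ * (1 / 2) ^ n := by
    intro k n
    have hwk : 0 < ‖w k‖ := norm_pos_iff.2 (hw0 k)
    have h1 : ‖z‖ / ‖w k‖ ≤ 1 / 2 := by
      rw [div_le_iff₀ hwk]
      linarith [hle k]
    calc ‖(w k ^ (n + 1))⁻¹ * z ^ n‖ = ‖w k‖⁻¹ * (‖z‖ / ‖w k‖) ^ n := by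
          rw [norm_mul, norm_inv, norm_pow, norm_pow, div_pow, pow_succ]
          field_simp
      _ ≤ _ := by gcongr
  -- Absolute summability over pairs (n, k) lets the two iterated sums be exchanged: over k first
  -- they give power sums, over n first -1/(z - w_k).
  have hprod : Summable fun p : ℕ × ι => ‖(w p.2 ^ (p.1 + 1))⁻¹ * z ^ p.1‖ := by
    have h1 := summable_geometric_two.mul_of_nonneg hs (fun _ => by positivity)
      (fun _ => by positivity)
    refine Summable.of_nonneg_of_le (fun _ => norm_nonneg _) (fun p => ?_) h1
    exact (hbound _ _).trans_eq (mul_comm _ _)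
  have hgeom : ∀ k, HasSum (fun n : ℕ => (w k ^ (n + 1))⁻¹ * z ^ n) (-(z - w k)⁻¹) := by
    intro k
    have hwk : 0 < ‖w k‖ := norm_pos_iff.2 (hw0 k)
    have hlt : ‖z / w k‖ < 1 := by
      rw [norm_div, div_lt_one hwk]
      linarith [hle k]
    have hne : z - w k ≠ 0 := by
      intro h
      rw [sub_eq_zero.1 h] at hz
      linarith [hle k]
    have hne' : 1 - z / w k ≠ 0 := by
      rw [Ne, sub_eq_zero, eq_comm, div_eq_one_iff_eq (hw0 k), ← sub_eq_zero]
      exact hne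
    have h := (hasSum_geometric_of_norm_lt_one hlt).mul_left (w k)⁻¹
    have hval : (w k)⁻¹ * (1 - z / w k)⁻¹ = -(z - w k)⁻¹ := by
      rw [← mul_inv, neg_inv]
      congr 1
      field_simp [hw0 k]
      ring
    rw [hval] at h
    refine h.congr_fun fun n => ?_
    · rw [div_pow, pow_succ]
      field_simp [hw0 k]
  have hlog := hw.hasSum_logDeriv hf h0 hB hC hgrow hle hz hfz
  have hsumk : ∀ n : ℕ, Summable fun k => ‖(w k ^ (n + 1))⁻¹ * z ^ n‖ := fun n =>
    hprod.prod_factor n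
  have hfst : ∀ n : ℕ, HasSum (fun k => (w k ^ (n + 1))⁻¹ * z ^ n)
      ((∑' k, (w k ^ (n + 1))⁻¹) * z ^ n) := fun n => by
    rw [← tsum_mul_right]
    exact (hsumk n).of_norm.hasSum
  refine ⟨hfz, ?_, ?_⟩
  · refine Summable.of_nonneg_of_le (fun _ => norm_nonneg _) (fun n => ?_) hprod.prod
    rw [← (hfst n).tsum_eq]
    exact norm_tsum_le_tsum_norm (hsumk n)
  · have h1 := hprod.of_norm.hasSum
    have h2 := h1.prod_fiberwise hfst
    have h3 := ((Equiv.prodComm ι ℕ).hasSum_iff.2 h1).prod_fiberwise hgeom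
    rw [← h3.unique hlog.neg] at *
    exact h2

lemma summable_inv_pow (hw : ListsZeros f w) (hf : Differentiable ℂ f) (h0 : f 0 ≠ 0)
    (hB : 0 ≤ B) (hC : 0 < C) (hgrow : ∀ z, ‖f z‖ ≤ C * Real.exp (B * √‖z‖)) {n : ℕ}
    (hn : 1 ≤ n) : Summable fun k => (w k ^ n)⁻¹ := by
  obtain ⟨m, rfl⟩ := Nat.exists_eq_add_of_le' hn
  obtain ⟨δ, hδ, hle⟩ := hw.exists_le_norm hf h0
  refine Summable.of_norm_bounded
    ((hw.summable_inv_norm hf h0 hB hC hgrow).mul_left (δ ^ m)⁻¹) fun k => ?_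
  have := hδ.trans_le (hle k)
  rw [norm_inv, norm_pow, pow_succ, mul_inv]
  gcongr
  exact hle k

end ListsZeros

/-! ### Entire functions given by power series. -/

lemma eq_of_hasSum_pow {a b : ℕ → ℂ} {f : ℂ → ℂ}
    (ha : ∀ᶠ z in 𝓝 0, HasSum (fun n => a n * z ^ n) (f z))
    (hb : ∀ᶠ z in 𝓝 0, HasSum (fun n => b n * z ^ n) (f z)) : a = b := by
  have h : ∀ c : ℕ → ℂ, (∀ᶠ z in 𝓝 0, HasSum (fun n => c n * z ^ n) (f z)) →
      HasFPowerSeriesAt f (FormalMultilinearSeries.ofScalars ℂ c) 0 := fun c hc => by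
    rw [hasFPowerSeriesAt_iff]
    filter_upwards [hc] with z hz
    simpa [mul_comm] using hz
  have := (h a ha).eq_formalMultilinearSeries (h b hb)
  exact FormalMultilinearSeries.ofScalars_series_injective ℂ ℂ this

lemma hasSum_deriv_of_entire {a : ℕ → ℂ} {f : ℂ → ℂ} (hf : Differentiable ℂ f)
    (ha : ∀ z, HasSum (fun n => a n * z ^ n) (f z)) (z : ℂ) :
    HasSum (fun n : ℕ => (n + 1) * a (n + 1) * z ^ n) (deriv f z) := by
  have h1 : a = fun n => (n.factorial : ℂ)⁻¹ * iteratedDeriv n f 0 := by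
    refine eq_of_hasSum_pow (f := f) (.of_forall ha) (.of_forall fun u => ?_)
    refine (Complex.hasSum_taylorSeries_of_entire hf 0 u).congr_fun fun n => ?_
    simp only [sub_zero, smul_eq_mul]
    ring
  refine (Complex.hasSum_taylorSeries_of_entire hf.deriv 0 z).congr_fun fun n => ?_
  rw [h1, ← iteratedDeriv_succ']
  simp only [sub_zero, smul_eq_mul, Nat.factorial_succ]
  push_cast
  have : (n : ℂ) + 1 ≠ 0 := Nat.cast_add_one_ne_zero n
  field_simp

/-- The majorant is C times the n-th term of cosh(√D √|z|); this is the source of the order 1/2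
growth. -/
lemma norm_pow_le_sqrt_series {a : ℕ → ℂ} {C D : ℝ} (hD : 0 ≤ D)
    (ha : ∀ n, ‖a n‖ ≤ C * (D ^ n / (2 * n).factorial)) (z : ℂ) (n : ℕ) :
    ‖a n * z ^ n‖ ≤ C * ((√D * √‖z‖) ^ (2 * n) / (2 * n).factorial) := by
  rw [norm_mul, norm_pow, mul_pow, pow_mul, pow_mul, Real.sq_sqrt hD,
    Real.sq_sqrt (norm_nonneg z)]
  calc ‖a n‖ * ‖z‖ ^ n ≤ C * (D ^ n / (2 * n).factorial) * ‖z‖ ^ n := by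
        gcongr
        exact ha n
    _ = _ := by ring

/-- A power series with coefficients `O(Dⁿ / (2n)!)` is entire. -/
lemma hasSum_of_coeff_le {a : ℕ → ℂ} {C D : ℝ} (hD : 0 ≤ D)
    (ha : ∀ n, ‖a n‖ ≤ C * (D ^ n / (2 * n).factorial)) (z : ℂ) :
    HasSum (fun n => a n * z ^ n) (∑' n, a n * z ^ n) :=
  (Summable.of_norm_bounded ((Real.hasSum_cosh (√D * √‖z‖)).summable.mul_left C)
    (norm_pow_le_sqrt_series hD ha z)).hasSum

lemma norm_tsum_le_of_coeff_le {a : ℕ → ℂ} {C D : ℝ} (hC : 0 ≤ C) (hD : 0 ≤ D)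
    (ha : ∀ n, ‖a n‖ ≤ C * (D ^ n / (2 * n).factorial)) (z : ℂ) :
    ‖∑' n, a n * z ^ n‖ ≤ C * Real.exp (√D * √‖z‖) := by
  refine (tsum_of_norm_bounded ((Real.hasSum_cosh (√D * √‖z‖)).mul_left C)
    (norm_pow_le_sqrt_series hD ha z)).trans ?_
  gcongr
  rw [← Real.cosh_add_sinh]
  have : 0 ≤ Real.sinh (√D * √‖z‖) := Real.sinh_nonneg_iff.2 (by positivity)
  linarith

lemma differentiable_tsum_of_coeff_le {a : ℕ → ℂ} {C D : ℝ} (hC : 0 ≤ C) (hD : 0 ≤ D)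
    (ha : ∀ n, ‖a n‖ ≤ C * (D ^ n / (2 * n).factorial)) :
    Differentiable ℂ fun z => ∑' n, a n * z ^ n := by
  intro z
  have hd : DifferentiableOn ℂ (fun z => ∑' n, a n * z ^ n) (ball 0 (‖z‖ + 1)) := by
    refine Complex.differentiableOn_tsum_of_summable_norm
      ((Real.hasSum_cosh (√D * √(‖z‖ + 1))).summable.mul_left C) (fun n => by fun_prop)
      isOpen_ball fun n u hu => (norm_pow_le_sqrt_series hD ha u n).trans ?_
    rw [mem_ball_zero_iff] at hu
    gcongr
  exact hd.differentiableAt (isOpen_ball.mem_nhds (by simp))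

/-! ### Polynomials and Newton's identities. -/

namespace ListsZeros

variable {ι : Type*} {f : ℂ → ℂ} {w : ι → ℂ} {C B : ℝ} {a : ℕ → ℂ}

/-- The zero-free cofactor has vanishing logarithmic derivative near 0, hence is constant by the
identity theorem, and f is a polynomial. Applied contrapositively, this gives infinitely many zeros.
-/
lemma coeff_ne_zero_finite [Finite ι] (hw : ListsZeros f w) (hf : Differentiable ℂ f)
    (h0 : f 0 ≠ 0)
    (hB : 0 ≤ B) (hC : 0 < C) (hgrow : ∀ z, ‖f z‖ ≤ C * Real.exp (B * √‖z‖))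
    (ha : ∀ z, HasSum (fun n => a n * z ^ n) (f z)) : ∃ N, ∀ n > N, a n = 0 := by
  have := Fintype.ofFinite ι
  obtain ⟨g, hg, hfg, -⟩ := hw.exists_eq_prod_mul hf h0 Finset.univ
  obtain ⟨δ, hδ, hle⟩ := hw.exists_le_norm hf h0
  have hlocal : deriv g =ᶠ[𝓝 0] 0 := by
    filter_upwards [hf.continuous.continuousAt.eventually_ne h0,
      closedBall_mem_nhds (0 : ℂ) (half_pos hδ)] with z hfz hz
    rw [mem_closedBall_zero_iff] at hz
    have h1 := (hw.hasSum_logDeriv hf h0 hB hC hgrow hle hz hfz).unique (hasSum_fintype _)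
    rw [logDeriv_prod_mul hg (hw.ne_zero h0) hfg hfz, add_eq_left, logDeriv_apply,
      div_eq_zero_iff] at h1
    refine h1.resolve_right fun h => hfz ?_
    rw [hfg, h, mul_zero]
  have hderiv : deriv g = 0 :=
    AnalyticOnNhd.eq_of_eventuallyEq (fun z _ => hg.deriv.analyticAt z)
      (fun z _ => analyticAt_const) hlocal
  have hconst : ∀ z, g z = g 0 := fun z =>
    is_const_of_deriv_eq_zero hg (fun z => congrFun hderiv z) z 0
  let p : Polynomial ℂ :=
    Polynomial.C (g 0) * ∏ k, (1 - Polynomial.C (w k)⁻¹ * Polynomial.X)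
  have hp : ∀ z, f z = p.eval z := fun z => by
    simp only [p, Polynomial.eval_mul, Polynomial.eval_C, Polynomial.eval_prod,
      Polynomial.eval_sub, Polynomial.eval_one, Polynomial.eval_X]
    rw [hfg, hconst, mul_comm]
    simp only [div_eq_inv_mul]
  have hcoeff : a = p.coeff := by
    refine eq_of_hasSum_pow (f := f) (.of_forall ha) (.of_forall fun z => ?_)
    rw [hp, Polynomial.eval_eq_sum_range]
    refine hasSum_sum_of_ne_finset_zero fun n hn => ?_
    rw [Polynomial.coeff_eq_zero_of_natDegree_lt (by simpa [Nat.lt_succ_iff] using hn), zero_mul]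
  exact ⟨p.natDegree, fun n hn => by rw [hcoeff, Polynomial.coeff_eq_zero_of_natDegree_lt hn]⟩

/-- Newton's identities for the zeros of an entire function, as an identity of power series. -/
lemma derivative_eq_neg_mul (hw : ListsZeros f w) (hf : Differentiable ℂ f) (h0 : f 0 ≠ 0)
    (hB : 0 ≤ B) (hC : 0 < C) (hgrow : ∀ z, ‖f z‖ ≤ C * Real.exp (B * √‖z‖))
    (ha : ∀ z, HasSum (fun n => a n * z ^ n) (f z)) :
    PowerSeries.derivative ℂ (PowerSeries.mk a) =
      -(PowerSeries.mk (fun n => ∑' k, (w k ^ (n + 1))⁻¹) * PowerSeries.mk a) := by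
  have key : (fun n : ℕ => (n + 1) * a (n + 1)) = fun n => PowerSeries.coeff n
      (-(PowerSeries.mk (fun n => ∑' k, (w k ^ (n + 1))⁻¹) * PowerSeries.mk a)) := by
    refine eq_of_hasSum_pow (f := deriv f) (.of_forall (hasSum_deriv_of_entire hf ha)) ?_
    filter_upwards [hw.hasSum_powerSum hf h0 hB hC hgrow] with z hz
    obtain ⟨hfz, hs1, hs⟩ := hz
    have hs2 := (ha z).summable.norm
    have h1 := (summable_norm_sum_mul_antidiagonal_of_summable_norm hs1 hs2).of_norm.hasSum
    rw [← tsum_mul_tsum_eq_tsum_sum_antidiagonal_of_summable_norm hs1 hs2, hs.tsum_eq,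
      (ha z).tsum_eq, logDeriv_apply, neg_mul, div_mul_cancel₀ _ hfz] at h1
    have h2 := h1.neg
    rw [neg_neg] at h2
    refine h2.congr_fun fun n => ?_
    rw [map_neg, PowerSeries.coeff_mul, neg_mul, Finset.sum_mul]
    congr 1
    refine Finset.sum_congr rfl fun p hp => ?_
    rw [← Finset.HasAntidiagonal.mem_antidiagonal.1 hp, pow_add]
    simp only [PowerSeries.coeff_mk]
    ring
  ext n
  rw [← congrFun key n, PowerSeries.coeff_derivative, PowerSeries.coeff_mk, mul_comm]

end ListsZeros

/-! ### The entire function attached to J_ν'. -/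

/-- The Taylor coefficients of `x ↦ (z / 2) ^ (-ν) * J_ν(z)`, where `x = z ^ 2`. -/
noncomputable def besselCoeff (ν : ℂ) (n : ℕ) : ℂ :=
  (-1) ^ n / (4 ^ n * (n.factorial : ℂ) * Complex.Gamma (ν + n + 1))

/-- The Taylor coefficients of `x ↦ 2 * (z / 2) ^ (1 - ν) * J_ν'(z)`, where `x = z ^ 2`. -/
noncomputable def besselDerivCoeff (ν : ℂ) (n : ℕ) : ℂ :=
  (2 * n + ν) * besselCoeff ν n

/-- The entire function of `x = z ^ 2` given by `2 * (z / 2) ^ (1 - ν) * J_ν'(z)`. -/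
noncomputable def besselDerivEntire (ν x : ℂ) : ℂ :=
  ∑' n, besselDerivCoeff ν n * x ^ n

section Bessel

variable {ν : ℂ} (hν : ∀ n : ℕ, ν ≠ -(n : ℂ))
include hν

lemma add_natCast_ne_zero (n : ℕ) : ν + n ≠ 0 := fun h => hν n (eq_neg_of_add_eq_zero_left h)

/-- This is Bessel's equation in coefficients; it yields both the growth bound and the second
equation of the first-order system. -/
lemma besselCoeff_succ (n : ℕ) :
    4 * (n + 1) * (ν + n + 1) * besselCoeff ν (n + 1) = -besselCoeff ν n := by
  have h1 : ν + n + 1 ≠ 0 := by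
    have := add_natCast_ne_zero hν (n + 1)
    push_cast at this
    rwa [add_assoc]
  have h2 : (n : ℂ) + 1 ≠ 0 := Nat.cast_add_one_ne_zero n
  have h3 : Complex.Gamma (ν + n + 1) ≠ 0 := Complex.Gamma_ne_zero fun m hm => by
    apply hν (n + 1 + m)
    push_cast
    linear_combination hm
  have h4 : (n.factorial : ℂ) ≠ 0 := Nat.cast_ne_zero.2 n.factorial_ne_zero
  rw [besselCoeff, besselCoeff, Nat.cast_succ, ← add_assoc, Complex.Gamma_add_one _ h1,
    Nat.factorial_succ]
  push_cast
  field_simp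
  ring

lemma besselCoeff_ne_zero (n : ℕ) : besselCoeff ν n ≠ 0 := by
  refine div_ne_zero (pow_ne_zero _ (by norm_num)) (mul_ne_zero (mul_ne_zero (by simp)
    (Nat.cast_ne_zero.2 n.factorial_ne_zero)) (Complex.Gamma_ne_zero fun m hm => ?_))
  apply hν (n + 1 + m)
  push_cast
  linear_combination hm

lemma besselDerivCoeff_ne_zero (n : ℕ) : besselDerivCoeff ν n ≠ 0 := by
  refine mul_ne_zero ?_ (besselCoeff_ne_zero hν n)
  have := add_natCast_ne_zero hν (2 * n)
  push_cast at this
  rwa [add_comm]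

/-- Since |ν + n + 1| tends to infinity and never vanishes, its inverses are bounded. The recurrence
then gives 4(n+1)² |c_(n+1)| ≤ K |c_n|, to be compared with (2n+2)(2n+1). -/
lemma exists_natCast_add_one_le : ∃ K : ℝ, 0 ≤ K ∧ ∀ n : ℕ, (n : ℝ) + 1 ≤ K * ‖ν + n + 1‖ := by
  have hn : ∀ n : ℕ, (n : ℝ) + 1 ≤ ‖ν + n + 1‖ + ‖ν‖ := fun n => by
    have h1 := norm_sub_le (ν + n + 1) ν
    have h2 : ν + n + 1 - ν = ((n + 1 : ℕ) : ℂ) := by push_cast; ring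
    rw [h2, Complex.norm_natCast] at h1
    exact_mod_cast h1
  have hlim : Tendsto (fun n : ℕ => ‖ν + n + 1‖) atTop atTop := by
    refine tendsto_atTop_mono (f := fun n : ℕ => (n : ℝ) - ‖ν‖) (fun n => by linarith [hn n]) ?_
    exact tendsto_atTop_add_const_right _ _ tendsto_natCast_atTop_atTop
  obtain ⟨M, hM⟩ := (tendsto_inv_atTop_zero.comp hlim).bddAbove_range
  have hM' : ∀ n : ℕ, ‖ν + n + 1‖⁻¹ ≤ M := fun n => hM ⟨n, rfl⟩
  have hM0 : 0 ≤ M := (inv_nonneg.2 (norm_nonneg _)).trans (hM' 0)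
  refine ⟨1 + ‖ν‖ * M, by positivity, fun n => (hn n).trans ?_⟩
  have hpos : 0 < ‖ν + n + 1‖ := norm_pos_iff.2 (by
    have := add_natCast_ne_zero hν (n + 1)
    push_cast at this
    rwa [add_assoc])
  have h1 : 1 ≤ M * ‖ν + n + 1‖ := by
    have := hM' n
    rwa [inv_eq_one_div, div_le_iff₀ hpos] at this
  nlinarith [mul_le_mul_of_nonneg_left h1 (norm_nonneg ν)]

lemma exists_norm_besselCoeff_le : ∃ C D : ℝ, 0 < C ∧ 0 ≤ D ∧
    (∀ n, ‖besselCoeff ν n‖ ≤ C * (D ^ n / (2 * n).factorial)) ∧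
    ∀ n, ‖besselDerivCoeff ν n‖ ≤ C * (D ^ n / (2 * n).factorial) := by
  obtain ⟨K, hK0, hK⟩ := exists_natCast_add_one_le hν
  have hb : ∀ n, ‖besselCoeff ν n‖ ≤ ‖besselCoeff ν 0‖ * (K ^ n / (2 * n).factorial) := by
    intro n
    induction n with
    | zero => simp
    | succ n ih =>
      have h1 := congrArg norm (besselCoeff_succ hν n)
      have h2 : ‖(n : ℂ) + 1‖ = n + 1 := by
        rw [← Nat.cast_succ, Complex.norm_natCast]
        push_cast
        rfl
      simp only [norm_mul, norm_neg, h2, Complex.norm_ofNat] at h1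
      have h3 : (4 : ℝ) * (n + 1) ^ 2 * ‖besselCoeff ν (n + 1)‖ ≤ K * ‖besselCoeff ν n‖ := by
        rw [← h1]
        have := mul_le_mul_of_nonneg_right (hK n)
          (by positivity : 0 ≤ 4 * ((n : ℝ) + 1) * ‖besselCoeff ν (n + 1)‖)
        linarith
      have h4 : ((2 * (n + 1)).factorial : ℝ) = (2 * n + 2) * (2 * n + 1) * (2 * n).factorial := by
        rw [show 2 * (n + 1) = 2 * n + 1 + 1 by ring, Nat.factorial_succ, Nat.factorial_succ]
        push_cast
        ring
      rw [← mul_div_assoc, le_div_iff₀ (by positivity)] at ih ⊢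
      rw [h4]
      calc ‖besselCoeff ν (n + 1)‖ * ((2 * n + 2) * (2 * n + 1) * (2 * n).factorial)
          ≤ 4 * (n + 1) ^ 2 * ‖besselCoeff ν (n + 1)‖ * (2 * n).factorial := by
            have : ((2 : ℝ) * n + 2) * (2 * n + 1) ≤ 4 * (n + 1) ^ 2 := by
              nlinarith [(Nat.cast_nonneg n : (0 : ℝ) ≤ n)]
            have := mul_le_mul_of_nonneg_right this
              (by positivity : 0 ≤ ‖besselCoeff ν (n + 1)‖ * (2 * n).factorial)
            linarith
        _ ≤ K * ‖besselCoeff ν n‖ * (2 * n).factorial := by gcongr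
        _ ≤ K * (‖besselCoeff ν 0‖ * K ^ n) := by rw [mul_assoc]; gcongr
        _ = _ := by ring
  have h0 : 0 < ‖besselCoeff ν 0‖ := norm_pos_iff.2 (besselCoeff_ne_zero hν 0)
  -- The extra factor |2n + ν| ≤ (1 + |ν|)4ⁿ of the derivative's coefficients is absorbed into the
  -- constant and into D = 4K.
  refine ⟨(1 + ‖ν‖) * ‖besselCoeff ν 0‖, 4 * K, by positivity, by positivity, fun n => ?_,
    fun n => ?_⟩
  · refine (hb n).trans ?_
    have h1 : (1 : ℝ) ≤ 1 + ‖ν‖ := by linarith [norm_nonneg ν]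
    have h2 : K ≤ 4 * K := by linarith
    gcongr
    exact le_mul_of_one_le_left h0.le h1
  · rw [besselDerivCoeff, norm_mul]
    have h1 : ‖2 * (n : ℂ) + ν‖ ≤ (1 + ‖ν‖) * 4 ^ n := by
      have h2 : ((2 * n + 1 : ℕ) : ℝ) ≤ ((4 ^ n : ℕ) : ℝ) := by
        refine Nat.cast_le.2 ?_
        have := one_add_mul_le_pow (R := ℤ) (a := 3) (by norm_num) n
        zify
        norm_num at this
        linarith [(Nat.cast_nonneg n : (0 : ℤ) ≤ n)]
      push_cast at h2
      have h3 : ‖2 * (n : ℂ) + ν‖ ≤ 2 * n + ‖ν‖ := (norm_add_le _ _).trans (by simp)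
      nlinarith [norm_nonneg ν, (Nat.cast_nonneg n : (0 : ℝ) ≤ n),
        mul_le_mul_of_nonneg_left h2 (norm_nonneg ν), mul_nonneg (norm_nonneg ν)
        (Nat.cast_nonneg n : (0 : ℝ) ≤ n)]
    refine (mul_le_mul h1 (hb n) (norm_nonneg _) (by positivity)).trans (le_of_eq ?_)
    rw [mul_pow]
    ring

lemma hasSum_besselDerivEntire (x : ℂ) :
    HasSum (fun n => besselDerivCoeff ν n * x ^ n) (besselDerivEntire ν x) := by
  obtain ⟨C, D, hC, hD, -, h⟩ := exists_norm_besselCoeff_le hν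
  exact hasSum_of_coeff_le hD h x

lemma differentiable_besselDerivEntire : Differentiable ℂ (besselDerivEntire ν) := by
  obtain ⟨C, D, hC, hD, -, h⟩ := exists_norm_besselCoeff_le hν
  exact differentiable_tsum_of_coeff_le hC.le hD h

lemma exists_norm_besselDerivEntire_le : ∃ B C : ℝ, 0 ≤ B ∧ 0 < C ∧
    ∀ x, ‖besselDerivEntire ν x‖ ≤ C * Real.exp (B * √‖x‖) := by
  obtain ⟨C, D, hC, hD, -, h⟩ := exists_norm_besselCoeff_le hν
  exact ⟨√D, C, Real.sqrt_nonneg _, hC, norm_tsum_le_of_coeff_le hC.le hD h⟩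

lemma besselDerivEntire_zero_ne_zero : besselDerivEntire ν 0 ≠ 0 := by
  have h : besselDerivEntire ν 0 = besselDerivCoeff ν 0 := by
    rw [besselDerivEntire, tsum_eq_single 0 fun n hn => by rw [zero_pow hn, mul_zero], pow_zero,
      mul_one]
  rw [h]
  exact besselDerivCoeff_ne_zero hν 0

omit hν in
lemma besselJ_eq {z : ℂ} (hz : z ≠ 0) :
    besselJ ν z = (z / 2) ^ ν * ∑' n, besselCoeff ν n * (z ^ 2) ^ n := by
  rw [besselJ, ← tsum_mul_left]
  refine tsum_congr fun n => ?_
  have h : (2 * (n : ℂ)) = ((2 * n : ℕ) : ℂ) := by push_cast; rfl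
  rw [Complex.cpow_add _ _ (div_ne_zero hz two_ne_zero), h, Complex.cpow_natCast, besselCoeff,
    div_pow, pow_mul 2, ← pow_mul z]
  norm_num
  ring

/-- The product rule for (z/2)^ν G(z²) leaves the factor νG + 2xG' at x = z², which `hF` identifies
with `besselDerivEntire`. -/
lemma besselJDeriv_eq {z : ℂ} (hz : z ∈ Complex.slitPlane) :
    besselJDeriv ν z = (z / 2) ^ (ν - 1) * (1 / 2) * besselDerivEntire ν (z ^ 2) := by
  obtain ⟨C, D, hC, hD, h, -⟩ := exists_norm_besselCoeff_le hν
  set G : ℂ → ℂ := fun x => ∑' n, besselCoeff ν n * x ^ n with hG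
  have hGd : Differentiable ℂ G := differentiable_tsum_of_coeff_le hC.le hD h
  have hGs : ∀ x, HasSum (fun n => besselCoeff ν n * x ^ n) (G x) := hasSum_of_coeff_le hD h
  have hF : ∀ x, besselDerivEntire ν x = ν * G x + 2 * (x * deriv G x) := by
    intro x
    have h1 : HasSum (fun n : ℕ => n * besselCoeff ν n * x ^ n) (x * deriv G x) := by
      rw [← hasSum_nat_add_iff' 1]
      simp only [Finset.range_one, Finset.sum_singleton, Nat.cast_zero, zero_mul, sub_zero]
      refine ((hasSum_deriv_of_entire hGd hGs x).mul_left x).congr_fun fun n => ?_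
      push_cast
      ring
    refine (hasSum_besselDerivEntire hν x).unique ?_
    refine (((hGs x).mul_left ν).add (h1.mul_left 2)).congr_fun fun n => ?_
    rw [besselDerivCoeff]
    ring
  have hz0 : z ≠ 0 := Complex.slitPlane_ne_zero hz
  have hz2 : z / 2 ∈ Complex.slitPlane := by
    rw [Complex.mem_slitPlane_iff] at hz ⊢
    simpa using hz
  have heq : besselJ ν =ᶠ[𝓝 z] fun u => (u / 2) ^ ν * G (u ^ 2) := by
    filter_upwards [isOpen_ne.mem_nhds hz0] with u hu
    exact besselJ_eq hu
  have h1 : HasDerivAt (fun u : ℂ => (u / 2) ^ ν) (ν * (z / 2) ^ (ν - 1) * (1 / 2)) z :=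
    ((hasDerivAt_id z).div_const 2).cpow_const hz2
  have h2 : HasDerivAt (fun u : ℂ => G (u ^ 2)) (deriv G (z ^ 2) * (2 * z)) z := by
    refine ((hGd (z ^ 2)).hasDerivAt.comp z (hasDerivAt_pow 2 z)).congr_deriv ?_
    simp
  have h3 : (z / 2) ^ ν = (z / 2) ^ (ν - 1) * (z / 2) := by
    rw [Complex.cpow_sub _ _ (div_ne_zero hz0 two_ne_zero), Complex.cpow_one,
      div_mul_cancel₀ _ (div_ne_zero hz0 two_ne_zero)]
  rw [besselJDeriv, heq.deriv_eq, (h1.fun_mul h2).deriv, hF, h3]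
  ring

/-- Multiplicity survives because the power prefactor does not vanish and squaring has nonzero
derivative away from 0. -/
lemma analyticOrderAt_besselJDeriv {z : ℂ} (hz : z ∈ Complex.slitPlane) :
    analyticOrderAt (besselJDeriv ν) z = analyticOrderAt (besselDerivEntire ν) (z ^ 2) := by
  have hz0 : z ≠ 0 := Complex.slitPlane_ne_zero hz
  have hz2 : z / 2 ∈ Complex.slitPlane := by
    rw [Complex.mem_slitPlane_iff] at hz ⊢
    simpa using hz
  have heq : besselJDeriv ν =ᶠ[𝓝 z]
      (fun u => (u / 2) ^ (ν - 1) * (1 / 2)) * (besselDerivEntire ν ∘ fun u => u ^ 2) := by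
    filter_upwards [Complex.isOpen_slitPlane.mem_nhds hz] with u hu
    exact besselJDeriv_eq hν hu
  have h1 : AnalyticAt ℂ (fun u : ℂ => (u / 2) ^ (ν - 1) * (1 / 2)) z :=
    ((analyticAt_id.div analyticAt_const two_ne_zero).cpow analyticAt_const hz2).mul
      analyticAt_const
  have h2 : AnalyticAt ℂ (fun u : ℂ => u ^ 2) z := analyticAt_id.pow 2
  have h3 : AnalyticAt ℂ (besselDerivEntire ν ∘ fun u => u ^ 2) z :=
    ((differentiable_besselDerivEntire hν).comp (differentiable_id.pow 2)).analyticAt z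
  rw [analyticOrderAt_congr heq, analyticOrderAt_mul h1 h3,
    analyticOrderAt_comp_of_deriv_ne_zero h2 (by simp [hz0]), h1.analyticOrderAt_eq_zero.2, zero_add]
  have : (z / 2) ^ (ν - 1) ≠ 0 := by
    rw [Ne, Complex.cpow_eq_zero_iff]
    exact fun h => div_ne_zero hz0 two_ne_zero h.1
  simpa using this

end Bessel

/-! ### Passing between zeros in z and zeros in x = z². -/

lemma halfPlane_subset_slitPlane : halfPlane ⊆ Complex.slitPlane := by
  rintro z (h | ⟨-, h⟩)
  · exact Or.inl h
  · exact Or.inr h.ne'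

lemma eq_of_sq_eq_of_mem_halfPlane {z s : ℂ} (hz : z ∈ halfPlane) (hs : s ∈ halfPlane)
    (h : z ^ 2 = s ^ 2) : z = s := by
  refine (sq_eq_sq_iff_eq_or_eq_neg.1 h).resolve_right ?_
  rintro rfl
  simp only [halfPlane, Set.mem_ofPred_eq, Complex.neg_re, Complex.neg_im] at hz hs
  rcases hs with hs | ⟨hs, hs'⟩ <;> rcases hz with hz | ⟨hz, hz'⟩ <;> linarith

lemma exists_mem_halfPlane_sq_eq {x : ℂ} (hx : x ≠ 0) : ∃ s ∈ halfPlane, s ^ 2 = x := by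
  obtain ⟨s, hs⟩ := IsAlgClosed.exists_pow_nat_eq x two_pos
  have hs0 : s ≠ 0 := by rintro rfl; exact hx (by simpa using hs.symm)
  by_cases h : s ∈ halfPlane
  · exact ⟨s, h, hs⟩
  · refine ⟨-s, ?_, by rw [neg_sq, hs]⟩
    simp only [halfPlane, Set.mem_ofPred_eq, Complex.neg_re, Complex.neg_im, not_or, not_and,
      not_lt] at h ⊢
    rcases h.1.lt_or_eq with h1 | h1
    · exact Or.inl (by linarith)
    · refine Or.inr ⟨by simp [h1], ?_⟩
      rcases (h.2 h1).lt_or_eq with h2 | h2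
      · linarith
      · exact absurd (Complex.ext h1 h2) hs0

section Bessel

variable {ν : ℂ} (hν : ∀ n : ℕ, ν ≠ -(n : ℂ))
include hν

/-- Squaring maps the half-plane bijectively onto the nonzero complex numbers, and 0 is not a zero
of the entire function. -/
lemma IsBesselDerivZeroSeq.listsZeros {j : ℕ → ℂ} (hj : IsBesselDerivZeroSeq ν j) :
    ListsZeros (besselDerivEntire ν) fun k => j k ^ 2 := by
  intro x
  rcases eq_or_ne x 0 with rfl | hx
  · have h1 : {k | j k ^ 2 = 0} = ∅ := by
      ext k
      simpa using Complex.slitPlane_ne_zero (halfPlane_subset_slitPlane (hj.mem k))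
    rw [h1, Set.encard_empty, eq_comm,
      ((differentiable_besselDerivEntire hν).analyticAt 0).analyticOrderAt_eq_zero]
    exact besselDerivEntire_zero_ne_zero hν
  · obtain ⟨s, hs, rfl⟩ := exists_mem_halfPlane_sq_eq hx
    rw [← analyticOrderAt_besselJDeriv hν (halfPlane_subset_slitPlane hs), ← hj.count s hs]
    congr 1
    ext k
    exact ⟨eq_of_sq_eq_of_mem_halfPlane (hj.mem k) hs, fun h => by
      rw [Set.mem_ofPred_eq] at h
      exact congrArg (· ^ 2) h⟩

lemma exists_isBesselDerivZeroSeq : ∃ j : ℕ → ℂ, IsBesselDerivZeroSeq ν j := by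
  set f := besselDerivEntire ν with hfdef
  have hf : Differentiable ℂ f := differentiable_besselDerivEntire hν
  have h0 : f 0 ≠ 0 := besselDerivEntire_zero_ne_zero hν
  obtain ⟨B, C, hB, hC, hgrow⟩ := exists_norm_besselDerivEntire_le hν
  have htop : ∀ z, analyticOrderAt f z ≠ ⊤ := fun z h => by
    rw [AnalyticOnNhd.analyticOrderAt_eq_top_iff_eq_zero z fun z => hf.analyticAt z] at h
    exact h0 (congrFun h 0)
  -- One index per zero and per unit of multiplicity. The type is infinite since F is no polynomial,
  -- and countable as the support of a summable family; hence it is in bijection with ℕ.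
  let w : (Σ z : ℂ, Fin (analyticOrderNatAt f z)) → ℂ := Sigma.fst
  have hw : ListsZeros f w := by
    intro z
    have h1 : {k | w k = z} = Set.range (Sigma.mk (β := fun z => Fin (analyticOrderNatAt f z)) z) := by
      ext ⟨u, i⟩
      constructor
      · rintro rfl
        exact ⟨i, rfl⟩
      · rintro ⟨i', h⟩
        exact (congrArg Sigma.fst h).symm
    rw [h1, ← Set.image_univ, sigma_mk_injective.encard_image, Set.encard_univ,
      ENat.card_eq_coe_fintype_card, Fintype.card_fin, Nat.cast_analyticOrderNatAt (htop z)]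
  have hw0 := hw.ne_zero h0
  have hinf : Infinite (Σ z : ℂ, Fin (analyticOrderNatAt f z)) := by
    by_contra hfin
    rw [not_infinite_iff_finite] at hfin
    obtain ⟨N, hN⟩ := hw.coeff_ne_zero_finite hf h0 hB hC hgrow (hasSum_besselDerivEntire hν)
    exact besselDerivCoeff_ne_zero hν (N + 1) (hN _ N.lt_succ_self)
  have hcount : Countable (Σ z : ℂ, Fin (analyticOrderNatAt f z)) := by
    have h1 := (hw.summable_inv_norm hf h0 hB hC hgrow).countable_support
    have h2 : Function.support (fun k => ‖w k‖⁻¹) = Set.univ := by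
      ext k
      simpa using hw0 k
    rw [h2] at h1
    exact Set.countable_univ_iff.1 h1
  obtain ⟨e⟩ : Nonempty (ℕ ≃ Σ z : ℂ, Fin (analyticOrderNatAt f z)) := nonempty_equiv_of_countable
  choose r hr hrsq using fun k => exists_mem_halfPlane_sq_eq (hw0 k)
  refine ⟨fun n => r (e n), fun n => hr _, fun z hz => ?_⟩
  rw [analyticOrderAt_besselJDeriv hν (halfPlane_subset_slitPlane hz), ← hfdef, ← hw (z ^ 2),
    ← e.injective.encard_image]
  congr 1
  ext k
  rw [e.image_eq_preimage_symm]
  simp only [Set.mem_preimage, Set.mem_ofPred_eq, Equiv.apply_symm_apply]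
  rw [← hrsq k]
  exact ⟨fun h => by rw [h], eq_of_sq_eq_of_mem_halfPlane (hr k) hz⟩

end Bessel

/-! ### The Riccati equation and its coefficients. -/

open PowerSeries in
/-- The Riccati equation satisfied by the logarithmic derivative `-T / X` of `A`. -/
lemma powerSeries_riccati {ν : ℂ} {A B T : PowerSeries ℂ}
    (h1 : A = 2 * X * derivative ℂ B + C ν * B)
    (h2 : 2 * X * derivative ℂ A + C ν * A = (C ν ^ 2 - X) * B)
    (h3 : X * derivative ℂ A = -(T * A)) (hA : A ≠ 0) :
    (C ν ^ 2 - X) * (C 4 * (T ^ 2 - X * derivative ℂ T) - C (4 * ν) * T + X) =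
      -(X * (C (2 * ν) - C 4 * T)) := by
  have h4 : (C ν - 2 * T) * A = (C ν ^ 2 - X) * B := by linear_combination h2 - 2 * h3
  have hd : -2 * derivative ℂ T * A + (C ν - 2 * T) * derivative ℂ A =
      -B + (C ν ^ 2 - X) * derivative ℂ B := by
    have hX : derivative ℂ (X : PowerSeries ℂ) = 1 := derivative_X
    have hc : ∀ c : ℂ, derivative ℂ (C c) = 0 := fun c => derivative_C
    have h2' : (2 : PowerSeries ℂ) = C 2 := (map_ofNat C 2).symm
    have h := congrArg (derivative ℂ) h4
    simp only [Derivation.leibniz, smul_eq_mul, map_sub, Derivation.leibniz_pow, hX, hc, h2',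
      mul_zero, add_zero] at h
    rw [h2']
    linear_combination h
  have hc4 : (C 4 : PowerSeries ℂ) = 4 := map_ofNat C 4
  have hc2 : (C 2 : PowerSeries ℂ) = 2 := map_ofNat C 2
  rw [map_mul, map_mul, hc4, hc2]
  -- After multiplication by A, the relation `h4`, its derivative `hd` and the system suffice to
  -- eliminate B and B'.
  refine mul_right_cancel₀ hA ?_
  linear_combination (C ν ^ 2 - X) * (2 * X * hd - 2 * (C ν - 2 * T) * h3
    - (C ν ^ 2 - X) * h1 + C ν * h4) + 2 * X * h4

open PowerSeries in
-- Coefficient of X^(k+1). The indicators come from the isolated X and the constant 2ν; they affect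
-- only k = 0 and k = 1.
lemma coeff_riccati {ν : ℂ} {t : ℕ → ℂ}
    (h : (C ν ^ 2 - X) *
      (C 4 * (mk t ^ 2 - X * derivative ℂ (mk t)) - C (4 * ν) * mk t + X) =
      -(X * (C (2 * ν) - C 4 * mk t))) (k : ℕ) :
    ν ^ 2 * (4 * coeff (k + 1) (mk t ^ 2) - 4 * (k + 1 + ν) * t (k + 1) + if k = 0 then 1 else 0)
      - (4 * coeff k (mk t ^ 2) - 4 * (k + ν) * t k + if k = 1 then 1 else 0) =
    4 * t k - if k = 0 then 2 * ν else 0 := by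
  have hu : ∀ n, coeff n (C 4 * (mk t ^ 2 - X * derivative ℂ (mk t)) - C (4 * ν) * mk t + X) =
      4 * coeff n (mk t ^ 2) - 4 * (n + ν) * t n + if n = 1 then 1 else 0 := by
    intro n
    have hd : coeff n (X * derivative ℂ (mk t)) = n * t n := by
      cases n with
      | zero => simp
      | succ n => rw [coeff_succ_X_mul, coeff_derivative, coeff_mk]; push_cast; ring
    rw [map_add, map_sub, coeff_C_mul, coeff_C_mul, map_sub, hd, coeff_mk, coeff_X]
    ring
  have h1 := congrArg (coeff (k + 1)) h
  rw [sub_mul, map_sub, ← map_pow, coeff_C_mul, coeff_succ_X_mul, hu, hu, map_neg,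
    coeff_succ_X_mul, map_sub, coeff_C_mul, coeff_mk, coeff_C] at h1
  simp only [Nat.add_eq_right] at h1
  push_cast at h1
  rw [h1]
  ring

/-- The vanishing of t 0 removes both end terms of the convolution. -/
lemma sum_antidiagonal_eq_sum_Icc {t : ℕ → ℂ} (h0 : t 0 = 0) (n : ℕ) :
    PowerSeries.coeff (n + 1) (PowerSeries.mk t ^ 2) =
      ∑ m ∈ Finset.Icc 1 n, t m * t (n + 1 - m) := by
  rw [sq, PowerSeries.coeff_mul, Finset.Nat.sum_antidiagonal_eq_sum_range_succ_mk,
    Finset.sum_range_succ, Finset.sum_range_succ']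
  simp only [PowerSeries.coeff_mk, h0, zero_mul, add_zero, Nat.sub_self, mul_zero]
  rw [Finset.range_eq_Ico, Finset.sum_Ico_add' (fun m => t m * t (n + 1 - m)) 0 n 1]
  rfl

section Bessel

variable {ν : ℂ} (hν : ∀ n : ℕ, ν ≠ -(n : ℂ))
include hν

/-- The recurrence between the power sums, before the terms of low index are separated. -/
lemma IsBesselDerivZeroSeq.rayleighTau_riccati {j : ℕ → ℂ} (hj : IsBesselDerivZeroSeq ν j)
    (t : ℕ → ℂ) (ht0 : t 0 = 0) (ht : ∀ n, t (n + 1) = rayleighTau j (n + 1)) (k : ℕ) :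
    ν ^ 2 * (4 * PowerSeries.coeff (k + 1) (PowerSeries.mk t ^ 2)
        - 4 * (k + 1 + ν) * t (k + 1) + if k = 0 then 1 else 0)
      - (4 * PowerSeries.coeff k (PowerSeries.mk t ^ 2) - 4 * (k + ν) * t k
        + if k = 1 then 1 else 0) =
    4 * t k - if k = 0 then 2 * ν else 0 := by
  obtain ⟨B, C, hB, hC, hgrow⟩ := exists_norm_besselDerivEntire_le hν
  have hder := (hj.listsZeros hν).derivative_eq_neg_mul (differentiable_besselDerivEntire hν)
    (besselDerivEntire_zero_ne_zero hν) hB hC hgrow (hasSum_besselDerivEntire hν)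
  have h2 : (2 : PowerSeries ℂ) = PowerSeries.C 2 := (map_ofNat PowerSeries.C 2).symm
  refine coeff_riccati (powerSeries_riccati (A := PowerSeries.mk (besselDerivCoeff ν))
    (B := PowerSeries.mk (besselCoeff ν)) ?_ ?_ ?_ ?_) k
  · ext n
    rw [h2, map_add, mul_assoc, PowerSeries.coeff_C_mul, PowerSeries.coeff_C_mul]
    cases n with
    | zero => simp [besselDerivCoeff]
    | succ n =>
      simp only [PowerSeries.coeff_succ_X_mul, PowerSeries.coeff_derivative, PowerSeries.coeff_mk,
        besselDerivCoeff]
      push_cast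
      ring
  · ext n
    rw [h2, map_add, mul_assoc, PowerSeries.coeff_C_mul, PowerSeries.coeff_C_mul, sub_mul, map_sub,
      ← map_pow, PowerSeries.coeff_C_mul]
    cases n with
    | zero => simp [besselDerivCoeff]; ring
    | succ n =>
      simp only [PowerSeries.coeff_succ_X_mul, PowerSeries.coeff_derivative, PowerSeries.coeff_mk,
        besselDerivCoeff]
      push_cast
      linear_combination besselCoeff_succ hν n
  · have hT : PowerSeries.mk t =
        PowerSeries.X * PowerSeries.mk fun n => ∑' k, ((j k ^ 2) ^ (n + 1))⁻¹ := by
      ext n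
      cases n with
      | zero => simp [ht0]
      | succ n =>
        simp only [PowerSeries.coeff_succ_X_mul, PowerSeries.coeff_mk, ht, rayleighTau, ← pow_mul]
    rw [hder, hT]
    ring
  · intro h
    have := congrArg (PowerSeries.coeff 0) h
    rw [PowerSeries.coeff_mk, map_zero] at this
    exact besselDerivCoeff_ne_zero hν 0 this

end Bessel

/-! ### Reading off the power sums. -/

theorem mainTheorem3 (ν : ℂ) (hν : ∀ n : ℕ, ν ≠ -(n : ℂ)) :
    (∃ j : ℕ → ℂ, IsBesselDerivZeroSeq ν j) ∧
    ∀ j : ℕ → ℂ, IsBesselDerivZeroSeq ν j →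
      (∀ n : ℕ, 1 ≤ n → Summable (fun k => ((j k) ^ (2 * n))⁻¹)) ∧
      rayleighTau j 1 = (ν + 2) / (4 * (ν + 1) * ν) ∧
      rayleighTau j 2 =
        (-4 * ν ^ 2 * rayleighTau j 1 ^ 2 - 4 * ν * rayleighTau j 1 + 1)
          / (-4 * ν ^ 2 * (ν + 2)) ∧
      ν ^ 2 * (ν + 3) * rayleighTau j 3 =
        (ν + 1) * rayleighTau j 2 + 2 * ν ^ 2 * rayleighTau j 1 * rayleighTau j 2
          - rayleighTau j 1 ^ 2 ∧
      (∀ k : ℕ, 3 ≤ k →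
        -ν ^ 2 * (k + ν + 1) * rayleighTau j (k + 1) =
          -(k + ν - 1) * rayleighTau j k
            - ν ^ 2 * ∑ m ∈ Finset.Icc 1 k, rayleighTau j m * rayleighTau j (k - m + 1)
            + ∑ m ∈ Finset.Icc 1 (k - 1), rayleighTau j m * rayleighTau j (k - m)) ∧
      rayleighTau j 2 =
        (ν ^ 2 + 8 * ν + 8) / (16 * ν ^ 2 * (ν + 1) ^ 2 * (ν + 2)) ∧
      rayleighTau j 3 =
        (ν ^ 3 + 16 * ν ^ 2 + 38 * ν + 24)
          / (32 * ν ^ 3 * (ν + 1) ^ 3 * (ν + 2) * (ν + 3)) := by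
  refine ⟨exists_isBesselDerivZeroSeq hν, fun j hj => ?_⟩
  have hν0 : ν ≠ 0 := by simpa using hν 0
  have hν1 : ν + 1 ≠ 0 := by simpa using add_natCast_ne_zero hν 1
  have hν2 : ν + 2 ≠ 0 := by simpa using add_natCast_ne_zero hν 2
  have hν3 : ν + 3 ≠ 0 := by simpa using add_natCast_ne_zero hν 3
  have hsum : ∀ n : ℕ, 1 ≤ n → Summable (fun k => ((j k) ^ (2 * n))⁻¹) := by
    intro n hn
    obtain ⟨B, C, hB, hC, hgrow⟩ := exists_norm_besselDerivEntire_le hν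
    simpa only [pow_mul] using (hj.listsZeros hν).summable_inv_pow
      (differentiable_besselDerivEntire hν) (besselDerivEntire_zero_ne_zero hν) hB hC hgrow hn
  -- T has no constant term, so t 0 is set to 0 rather than to `rayleighTau j 0`, which is formally
  -- a divergent sum of ones.
  obtain ⟨t, ht0, ht⟩ : ∃ t : ℕ → ℂ, t 0 = 0 ∧ ∀ n, t (n + 1) = rayleighTau j (n + 1) :=
    ⟨fun n => if n = 0 then 0 else rayleighTau j n, by simp, by simp⟩
  have ht' : ∀ n, 1 ≤ n → t n = rayleighTau j n := fun n hn => by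
    obtain ⟨m, rfl⟩ := Nat.exists_eq_add_of_le' hn
    exact ht m
  have key := hj.rayleighTau_riccati hν t ht0 ht
  have q0 : PowerSeries.coeff 0 (PowerSeries.mk t ^ 2) = 0 := by
    simp [ht0]
  -- The instances 0, 1, 2 determine τ₁, τ₂, τ₃ in turn.
  have k0 := key 0
  have k1 := key 1
  have k2 := key 2
  rw [sum_antidiagonal_eq_sum_Icc ht0] at k0 k1 k2
  rw [q0] at k0
  rw [sum_antidiagonal_eq_sum_Icc ht0] at k1 k2
  have s2 : ∑ m ∈ Finset.Icc 1 2, t m * t (2 + 1 - m) = t 1 * t 2 + t 2 * t 1 := by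
    rw [show Finset.Icc 1 2 = {1, 2} from rfl, Finset.sum_pair (by norm_num)]
  rw [s2] at k2
  simp only [Nat.cast_zero, Nat.cast_one, Nat.cast_ofNat] at k0 k1 k2
  norm_num [ht0, ht'] at k0 k1 k2
  set τ1 := rayleighTau j 1
  set τ2 := rayleighTau j 2
  set τ3 := rayleighTau j 3
  have e1 : τ1 = (ν + 2) / (4 * (ν + 1) * ν) := by
    rw [eq_div_iff (by simp [hν0, hν1])]
    refine mul_left_cancel₀ hν0 ?_
    linear_combination -k0
  have e2 : τ2 = (-4 * ν ^ 2 * τ1 ^ 2 - 4 * ν * τ1 + 1) / (-4 * ν ^ 2 * (ν + 2)) := by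
    rw [eq_div_iff (by simp [hν0, hν2])]
    linear_combination k1
  have e3 : ν ^ 2 * (ν + 3) * τ3 = (ν + 1) * τ2 + 2 * ν ^ 2 * τ1 * τ2 - τ1 ^ 2 := by
    linear_combination -k2 / 4
  have e2' : τ2 = (ν ^ 2 + 8 * ν + 8) / (16 * ν ^ 2 * (ν + 1) ^ 2 * (ν + 2)) := by
    rw [e2, e1]
    field_simp
    ring
  refine ⟨hsum, e1, e2, e3, fun k hk => ?_, e2', ?_⟩
  · obtain ⟨n, rfl⟩ := Nat.exists_eq_add_of_le' (show 1 ≤ k by omega)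
    have h := key (n + 1)
    rw [sum_antidiagonal_eq_sum_Icc ht0, sum_antidiagonal_eq_sum_Icc ht0, if_neg (by omega),
      if_neg (by omega), ht, ht] at h
    have s1 : ∑ m ∈ Finset.Icc 1 (n + 1), t m * t (n + 1 + 1 - m) =
        ∑ m ∈ Finset.Icc 1 (n + 1), rayleighTau j m * rayleighTau j (n + 1 - m + 1) := by
      refine Finset.sum_congr rfl fun m hm => ?_
      rw [Finset.mem_Icc] at hm
      rw [ht' _ hm.1, ht' _ (by omega), Nat.sub_add_comm hm.2]
    have s2 : ∑ m ∈ Finset.Icc 1 n, t m * t (n + 1 - m) =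
        ∑ m ∈ Finset.Icc 1 n, rayleighTau j m * rayleighTau j (n + 1 - m) := by
      refine Finset.sum_congr rfl fun m hm => ?_
      rw [Finset.mem_Icc] at hm
      rw [ht' _ hm.1, ht' _ (by omega)]
    rw [s1, s2] at h
    rw [Nat.add_sub_cancel]
    push_cast at h ⊢
    linear_combination h / 4
  · refine mul_left_cancel₀ (mul_ne_zero (pow_ne_zero 2 hν0) hν3) (e3.trans ?_)
    rw [e2', e1]
    field_simp
    ring
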